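/- Let $\mathbb{F}$ be an arbitrary field and let $\mathfrak{L}$ be a non-zero left Leibniz algebra over $\mathbb{F}$, i.e. a vector space with a bilinear product such that $x(yz)=(xy)z+y(xz)$ for all $x,y,z\in\mathfrak{L}$. Let $\mathrm{Leib}(\mathfrak{L})$ be the subspace (in fact ideal) spanned by all squares $x^2$, $x\in\mathfrak{L}$, and assume that the canonical Lie algebra $\mathfrak{L}_{\mathrm{Lie}}:=\mathfrak{L}/\mathrm{Leib}(\mathfrak{L})$ is finite-dimensional. Then the Grothendieck ring $\mathrm{Gr}^{\mathrm{bi}}(\mathfrak{L})$ of the category of finite-dimensional $\mathfrak{L}$-bimodules is not associative. Here an $\mathfrak{L}$-bimodule is a vector space $M$ with bilinear left and right $\mathfrak{L}$-actions satisfying $(xy)\cdot m=x\cdot(y\cdot m)-y\cdot(x\cdot m)$, $(x\cdot m)\cdot y=x\cdot(m\cdot y)-m\cdot(xy)$ and $(m\cdot x)\cdot y=m\cdot(xy)-x\cdot(m\cdot y)$ for all $x,y\in\mathfrak{L}$, $m\in M$. For $\mathfrak{L}$-bimodules $M,N$ the algebra $\mathfrak{L}$ acts on $M\otimes_{\mathbb{F}}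 N$ by $x\cdot(m\otimes n)=(x\cdot m)\otimes n+m\otimes(x\cdot n)$ and $(m\otimes n)\cdot x=(m\cdot x)\otimes n+m\otimes(n\cdot x)$, and $M\overline{\otimes}N:=(M\otimes_{\mathbb{F}} N)/T(M,N)$ is the truncated tensor product, where $T(M,N)$ is the smallest subspace of $M\otimes_{\mathbb{F}} N$ that is closed under both actions and contains all elements $(x\cdot m+m\cdot x)\otimes(n\cdot y)+(m\cdot y)\otimes(x\cdot n+n\cdot x)$ with $x,y\in\mathfrak{L}$, $m\in M$, $n\in N$; it is again an $\mathfrak{L}$-bimodule. The additive group of $\mathrm{Gr}^{\mathrm{bi}}(\mathfrak{L})$ is the free abelian group on the set $\mathrm{Irr}^{\mathrm{bi}}(\mathfrak{L})$ of isomorphism classes of finite-dimensional irreducible $\mathfrak{L}$-bimodules, and its multiplication is the biadditive extension of $$[M]\cdot[N]:=[M\overline{\otimes}N]:=\sum_{[S]\in\mathrm{Irr}^{\mathrm{bi}}(\mathfrak{L})}[M\overline{\otimes}N:S]\,[S]\qquad([M],[N]\in\mathrm{Irr}^{\mathrm{bi}}(\mathfrak{L})),$$ where $[X:S]$ denotes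 the multiplicity of $S$ in a composition series of $X$. -/

import Mathlib

open scoped TensorProduct

universe u v

set_option linter.unusedSectionVars false

noncomputable section

namespace Leibniz

/-- A (not necessarily associative) algebra is a left Leibniz algebra if every left multiplication
operator is a derivation. Bilinearity of the product is expressed by `NonUnitalNonAssocRing`
together with `IsScalarTower F L L` and `SMulCommClass F L L`. -/
class IsLeibniz (L : Type*) [NonUnitalNonAssocRing L] : Prop where
  mul_mul_eq : ∀ x y z : L, x * (y * z) = (x * y) * z + y * (x * z)

section Canonical

variable (F : Type u) [Field F] (L : Type v) [NonUnitalNonAssocRing L] [Module F L]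

/-- The Leibniz kernel: the subspace spanned by all squares. -/
def kernel : Submodule F L := Submodule.span F (Set.range fun x : L => x * x)

/-- The canonical Lie algebra `L / Leib(L)` (its bracket is defined below). -/
abbrev CanonicalLie : Type v := L ⧸ kernel F L

variable [IsScalarTower F L L] [SMulCommClass F L L] [IsLeibniz L]

theorem kernel_mul {a : L} (ha : a ∈ kernel F L) (y : L) : a * y = 0 := by
  induction ha using Submodule.span_induction with
  | mem a h =>
    obtain ⟨x, rfl⟩ := h
    have := IsLeibniz.mul_mul_eq x x y
    exact left_eq_add.mp (this.trans (add_comm _ _))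
  | zero => simp
  | add a b _ _ ha hb => rw [add_mul, ha, hb, add_zero]
  | smul c a _ ha => rw [smul_mul_assoc, ha, smul_zero]

theorem mul_kernel (y : L) {a : L} (ha : a ∈ kernel F L) : y * a ∈ kernel F L := by
  induction ha using Submodule.span_induction with
  | mem a h =>
    obtain ⟨x, rfl⟩ := h
    have hs : ∀ z : L, z * z ∈ kernel F L := fun z => Submodule.subset_span ⟨z, rfl⟩
    have : y * (x * x) = (y * x + x) * (y * x + x) - (y * x) * (y * x) - x * x := by
      rw [IsLeibniz.mul_mul_eq y x x, add_mul, mul_add, mul_add]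
      abel
    change y * (x * x) ∈ _
    rw [this]
    exact Submodule.sub_mem _ (Submodule.sub_mem _ (hs _) (hs _)) (hs _)
  | zero => simp
  | add a b _ _ ha hb => rw [mul_add]; exact Submodule.add_mem _ ha hb
  | smul c a _ ha => rw [mul_smul_comm]; exact Submodule.smul_mem _ c ha

/-- The product induced on `L / Leib(L)`. -/
def canonicalBracket : CanonicalLie F L →ₗ[F] CanonicalLie F L →ₗ[F] CanonicalLie F L :=
  (kernel F L).liftQ
    (LinearMap.mk₂ F
      (fun (x : L) (y : CanonicalLie F L) =>
        (kernel F L).mapQ (kernel F L) (LinearMap.mulLeft F x)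
          (fun _ ha => mul_kernel F L x ha) y)
      (by
        intro x x' y
        obtain ⟨y, rfl⟩ := (kernel F L).mkQ_surjective y
        exact congrArg (kernel F L).mkQ (add_mul x x' y))
      (by
        intro c x y
        obtain ⟨y, rfl⟩ := (kernel F L).mkQ_surjective y
        exact congrArg (kernel F L).mkQ (smul_mul_assoc c x y))
      (by intro x y y'; simp)
      (by intro c x y; simp))
    (by
      intro a ha
      ext y
      change (kernel F L).mkQ (a * y) = 0
      rw [kernel_mul F L ha, map_zero])

instance : Bracket (CanonicalLie F L) (CanonicalLie F L) := ⟨fun x y => canonicalBracket F L x y⟩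

theorem mk_lie_mk (x y : L) :
    ⁅(Submodule.Quotient.mk x : CanonicalLie F L), (Submodule.Quotient.mk y : CanonicalLie F L)⁆ =
      Submodule.Quotient.mk (x * y) := rfl

instance : LieRing (CanonicalLie F L) where
  add_lie x y z := by simp [Bracket.bracket]
  lie_add x y z := by simp [Bracket.bracket]
  lie_self x := by
    induction x using Submodule.Quotient.induction_on with | _ x =>
    rw [mk_lie_mk, Submodule.Quotient.mk_eq_zero]
    exact Submodule.subset_span ⟨x, rfl⟩
  leibniz_lie x y z := by
    induction x using Submodule.Quotient.induction_on with | _ x =>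
    induction y using Submodule.Quotient.induction_on with | _ y =>
    induction z using Submodule.Quotient.induction_on with | _ z =>
    simp only [mk_lie_mk, ← Submodule.Quotient.mk_add, IsLeibniz.mul_mul_eq x y z]

instance : LieAlgebra F (CanonicalLie F L) where
  lie_smul c x y := by simp [Bracket.bracket]

end Canonical

section Bimodules

variable (F : Type u) [Field F] (L : Type v) [NonUnitalNonAssocRing L] [Module F L]

/-- A weak `L`-bimodule structure on the vector space `V`: bilinear left and right actions
`x · m = left x m` and `m · x = right x m` satisfying (LLM) and (LML). -/
structure WeakBimodule (V : Type*) [AddCommGroup V] [Module F V] where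
  left : L →ₗ[F] V →ₗ[F] V
  right : L →ₗ[F] V →ₗ[F] V
  llm : ∀ x y m, left (x * y) m = left x (left y m) - left y (left x m)
  lml : ∀ x y m, right y (left x m) = left x (right y m) - right (x * y) m

/-- An `L`-bimodule structure on the vector space `V`: actions satisfying (LLM), (LML), (MLL). -/
structure Bimodule (V : Type*) [AddCommGroup V] [Module F V] extends WeakBimodule F L V where
  mll : ∀ x y m, right y (right x m) = right (x * y) m - left x (right y m)

variable {F L}
variable {V W U : Type*} [AddCommGroup V] [Module F V] [AddCommGroup W] [Module F W]
  [AddCommGroup U] [Module F U]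

namespace WeakBimodule

variable (ρ : WeakBimodule F L V)

/-- The lattice of (weak) subbimodules: subspaces closed under both actions. -/
def subs : Sublattice (Submodule F V) where
  carrier := {P | ∀ x, (∀ m ∈ P, ρ.left x m ∈ P) ∧ (∀ m ∈ P, ρ.right x m ∈ P)}
  supClosed' := by
    intro P hP Q hQ x
    constructor
    · intro m hm
      obtain ⟨p, hp, q, hq, rfl⟩ := Submodule.mem_sup.mp hm
      rw [map_add]
      exact Submodule.add_mem_sup ((hP x).1 p hp) ((hQ x).1 q hq)
    · intro m hm
      obtain ⟨p, hp, q, hq, rfl⟩ := Submodule.mem_sup.mp hm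
      rw [map_add]
      exact Submodule.add_mem_sup ((hP x).2 p hp) ((hQ x).2 q hq)
  infClosed' := by
    intro P hP Q hQ x
    exact ⟨fun m hm => ⟨(hP x).1 m hm.1, (hQ x).1 m hm.2⟩,
      fun m hm => ⟨(hP x).2 m hm.1, (hQ x).2 m hm.2⟩⟩

theorem bot_mem_subs : (⊥ : Submodule F V) ∈ ρ.subs := by
  intro x
  constructor <;> · intro m hm; rw [Submodule.mem_bot] at hm ⊢; simp [hm]

theorem top_mem_subs : (⊤ : Submodule F V) ∈ ρ.subs := fun _ => ⟨fun _ _ => trivial, fun _ _ => trivial⟩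

/-- The zero subbimodule and the whole bimodule. -/
instance : BoundedOrder ρ.subs where
  bot := ⟨⊥, ρ.bot_mem_subs⟩
  bot_le P := show (⊥ : Submodule F V) ≤ P.1 from bot_le
  top := ⟨⊤, ρ.top_mem_subs⟩
  le_top P := show P.1 ≤ (⊤ : Submodule F V) from le_top

instance : IsModularLattice ρ.subs where
  sup_inf_le_assoc_of_le {x} y {z} h :=
    IsModularLattice.sup_inf_le_assoc_of_le (α := Submodule F V) (x := x.1) y.1 (z := z.1) h

theorem sInf_mem_subs (S : Set (Submodule F V)) (hS : ∀ P ∈ S, P ∈ ρ.subs) : sInf S ∈ ρ.subs := by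
  intro x
  constructor <;> intro m hm <;> rw [Submodule.mem_sInf] at hm ⊢ <;> intro P hP
  · exact (hS P hP x).1 m (hm P hP)
  · exact (hS P hP x).2 m (hm P hP)

/-- The actions restricted to a subbimodule. -/
def restrict (P : Submodule F V) (hP : P ∈ ρ.subs) : WeakBimodule F L P where
  left := LinearMap.mk₂ F (fun x m => ⟨ρ.left x m, (hP x).1 m m.2⟩)
    (by intros; ext; simp) (by intros; ext; simp) (by intros; ext; simp) (by intros; ext; simp)
  right := LinearMap.mk₂ F (fun x m => ⟨ρ.right x m, (hP x).2 m m.2⟩)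
    (by intros; ext; simp) (by intros; ext; simp) (by intros; ext; simp) (by intros; ext; simp)
  llm x y m := by ext; exact ρ.llm x y m
  lml x y m := by ext; exact ρ.lml x y m

/-- The actions induced on the quotient by a subbimodule. -/
def quotient (P : Submodule F V) (hP : P ∈ ρ.subs) : WeakBimodule F L (V ⧸ P) where
  left := LinearMap.mk₂ F (fun x m => P.mapQ P (ρ.left x) (fun m hm => (hP x).1 m hm) m)
    (by intro x y m; induction m using Submodule.Quotient.induction_on; simp)
    (by intro x y m; induction m using Submodule.Quotient.induction_on; simp)
    (by intros; simp) (by intros; simp)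
  right := LinearMap.mk₂ F (fun x m => P.mapQ P (ρ.right x) (fun m hm => (hP x).2 m hm) m)
    (by intro x y m; induction m using Submodule.Quotient.induction_on; simp)
    (by intro x y m; induction m using Submodule.Quotient.induction_on; simp)
    (by intros; simp) (by intros; simp)
  llm x y m := by
    induction m using Submodule.Quotient.induction_on with | _ m =>
    exact congrArg P.mkQ (ρ.llm x y m)
  lml x y m := by
    induction m using Submodule.Quotient.induction_on with | _ m =>
    exact congrArg P.mkQ (ρ.lml x y m)

@[simp] theorem restrict_left (P : Submodule F V) (hP : P ∈ ρ.subs) (x : L) (m : P) :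
    ((ρ.restrict P hP).left x m : V) = ρ.left x m := rfl

@[simp] theorem restrict_right (P : Submodule F V) (hP : P ∈ ρ.subs) (x : L) (m : P) :
    ((ρ.restrict P hP).right x m : V) = ρ.right x m := rfl

@[simp] theorem quotient_left (P : Submodule F V) (hP : P ∈ ρ.subs) (x : L) (m : V) :
    (ρ.quotient P hP).left x (Submodule.Quotient.mk m) = Submodule.Quotient.mk (ρ.left x m) := rfl

@[simp] theorem quotient_right (P : Submodule F V) (hP : P ∈ ρ.subs) (x : L) (m : V) :
    (ρ.quotient P hP).right x (Submodule.Quotient.mk m) = Submodule.Quotient.mk (ρ.right x m) := rfl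

/-- The tensor product with `x · (m ⊗ n) = (x · m) ⊗ n + m ⊗ (x · n)` and
`(m ⊗ n) · x = (m · x) ⊗ n + m ⊗ (n · x)`. -/
def tensor (σ : WeakBimodule F L W) : WeakBimodule F L (V ⊗[F] W) where
  left := LinearMap.rTensorHom W ∘ₗ ρ.left + LinearMap.lTensorHom V ∘ₗ σ.left
  right := LinearMap.rTensorHom W ∘ₗ ρ.right + LinearMap.lTensorHom V ∘ₗ σ.right
  llm x y m := by
    induction m using TensorProduct.induction_on with
    | zero => simp
    | add a b ha hb => simp only [map_add, ha, hb]; abel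
    | tmul a b =>
      simp [ρ.llm, σ.llm, TensorProduct.sub_tmul, TensorProduct.tmul_sub]
      abel
  lml x y m := by
    induction m using TensorProduct.induction_on with
    | zero => simp
    | add a b ha hb => simp only [map_add, ha, hb]; abel
    | tmul a b =>
      simp [ρ.lml, σ.lml, TensorProduct.sub_tmul, TensorProduct.tmul_sub]
      abel

@[simp] theorem tensor_left (σ : WeakBimodule F L W) (x : L) (m : V) (n : W) :
    (ρ.tensor σ).left x (m ⊗ₜ n) = ρ.left x m ⊗ₜ n + m ⊗ₜ σ.left x n := rfl

@[simp] theorem tensor_right (σ : WeakBimodule F L W) (x : L) (m : V) (n : W) :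
    (ρ.tensor σ).right x (m ⊗ₜ n) = ρ.right x m ⊗ₜ n + m ⊗ₜ σ.right x n := rfl

/-- The set `S(M,N)` of all `(x·m + m·x) ⊗ (n·y) + (m·y) ⊗ (x·n + n·x)`. -/
def truncSet (σ : WeakBimodule F L W) : Set (V ⊗[F] W) :=
  {t | ∃ (x y : L) (m : V) (n : W),
    t = (ρ.left x m + ρ.right x m) ⊗ₜ[F] σ.right y n + ρ.right y m ⊗ₜ[F] (σ.left x n + σ.right x n)}

/-- `T(M,N)`: the smallest subspace of `M ⊗ N` that contains `S(M,N)` and is closed under both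
actions. -/
def truncSub (σ : WeakBimodule F L W) : Submodule F (V ⊗[F] W) :=
  sInf {P | P ∈ (ρ.tensor σ).subs ∧ ρ.truncSet σ ⊆ P}

theorem truncSub_mem (σ : WeakBimodule F L W) : ρ.truncSub σ ∈ (ρ.tensor σ).subs :=
  sInf_mem_subs _ _ fun _ h => h.1

theorem truncSet_subset (σ : WeakBimodule F L W) : ρ.truncSet σ ⊆ ρ.truncSub σ :=
  fun _ ht => Submodule.mem_sInf.mpr fun _ hP => hP.2 ht

end WeakBimodule

namespace Bimodule

variable (ρ : Bimodule F L V) (σ : Bimodule F L W) (τ : Bimodule F L U)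

/-- The restriction of a bimodule structure to a subbimodule. -/
def restrict (P : Submodule F V) (hP : P ∈ ρ.subs) : Bimodule F L P where
  toWeakBimodule := ρ.toWeakBimodule.restrict P hP
  mll x y m := by ext; exact ρ.mll x y m

/-- The quotient of a bimodule by a subbimodule. -/
def quotient (P : Submodule F V) (hP : P ∈ ρ.subs) : Bimodule F L (V ⧸ P) where
  toWeakBimodule := ρ.toWeakBimodule.quotient P hP
  mll x y m := by
    induction m using Submodule.Quotient.induction_on with | _ m =>
    exact congrArg P.mkQ (ρ.mll x y m)

theorem comap_mem_subs (P Q : ρ.subs) :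
    P.1.comap Q.1.subtype ∈ (ρ.restrict Q.1 Q.2).subs :=
  fun x => ⟨fun m hm => (P.2 x).1 m hm, fun m hm => (P.2 x).2 m hm⟩

/-- For subbimodules `P ≤ Q`, the subquotient `Q / P`. -/
def subquotient (P Q : ρ.subs) : Bimodule F L (Q.1 ⧸ P.1.comap Q.1.subtype) :=
  (ρ.restrict Q.1 Q.2).quotient _ (ρ.comap_mem_subs P Q)

theorem zd (x y : L) (m : V) : ρ.right y (ρ.left x m) + ρ.right y (ρ.right x m) = 0 := by
  rw [ρ.lml, ρ.mll]; abel

theorem tensor_zd_mem (x y : L) (t : V ⊗[F] W) :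
    (ρ.tensor σ.toWeakBimodule).right y ((ρ.tensor σ.toWeakBimodule).left x t)
      + (ρ.tensor σ.toWeakBimodule).right y ((ρ.tensor σ.toWeakBimodule).right x t)
      ∈ ρ.truncSub σ.toWeakBimodule := by
  induction t using TensorProduct.induction_on with
  | zero => simp
  | add a b ha hb =>
    simp only [map_add]
    have := Submodule.add_mem _ ha hb
    rwa [add_add_add_comm] at this
  | tmul m n =>
    refine WeakBimodule.truncSet_subset _ _ ⟨x, y, m, n, ?_⟩
    have h1 : ρ.right y (ρ.right x m) = - ρ.right y (ρ.left x m) :=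
      eq_neg_of_add_eq_zero_right (ρ.zd x y m)
    have h2 : σ.right y (σ.right x n) = - σ.right y (σ.left x n) :=
      eq_neg_of_add_eq_zero_right (σ.zd x y n)
    simp only [WeakBimodule.tensor_left, WeakBimodule.tensor_right, map_add, h1, h2,
      TensorProduct.add_tmul, TensorProduct.tmul_add, TensorProduct.neg_tmul,
      TensorProduct.tmul_neg]
    abel

/-- The truncated tensor product `(M ⊗ N) / T(M,N)`, which is again a bimodule. -/
def truncTensor : Bimodule F L ((V ⊗[F] W) ⧸ ρ.truncSub σ.toWeakBimodule) where
  toWeakBimodule := (ρ.tensor σ.toWeakBimodule).quotient _ (ρ.truncSub_mem σ.toWeakBimodule)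
  mll x y t := by
    induction t using Submodule.Quotient.induction_on with | _ t =>
    have h := tensor_zd_mem ρ σ x y t
    rw [(ρ.tensor σ.toWeakBimodule).lml] at h
    rw [← Submodule.Quotient.mk_eq_zero] at h
    simp only [WeakBimodule.quotient_left, WeakBimodule.quotient_right]
    rw [← Submodule.Quotient.mk_sub, ← sub_eq_zero, ← Submodule.Quotient.mk_sub, ← h]
    congr 1
    abel

/-- Irreducible bimodules: non-zero, and without subbimodules other than zero and the whole. -/
def IsIrreducible : Prop := Nontrivial V ∧ ∀ P ∈ ρ.subs, P = ⊥ ∨ P = ⊤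

/-- Isomorphism of bimodules. -/
def Isomorphic : Prop :=
  ∃ e : V ≃ₗ[F] W, (∀ x m, e (ρ.left x m) = σ.left x (e m)) ∧
    (∀ x m, e (ρ.right x m) = σ.right x (e m))

variable {ρ σ τ}

theorem Isomorphic.refl (ρ : Bimodule F L V) : ρ.Isomorphic ρ :=
  ⟨LinearEquiv.refl F V, fun _ _ => rfl, fun _ _ => rfl⟩

theorem Isomorphic.symm (h : ρ.Isomorphic σ) : σ.Isomorphic ρ := by
  obtain ⟨e, h1, h2⟩ := h
  refine ⟨e.symm, fun x m => ?_, fun x m => ?_⟩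
  · rw [LinearEquiv.symm_apply_eq, h1, LinearEquiv.apply_symm_apply]
  · rw [LinearEquiv.symm_apply_eq, h2, LinearEquiv.apply_symm_apply]

theorem Isomorphic.trans (h : ρ.Isomorphic σ) (h' : σ.Isomorphic τ) : ρ.Isomorphic τ := by
  obtain ⟨e, h1, h2⟩ := h
  obtain ⟨f, h3, h4⟩ := h'
  exact ⟨e.trans f, fun x m => by simp [h1, h3], fun x m => by simp [h2, h4]⟩

/-- The factor `Q / P` of a maximal inclusion `P ⋖ Q` of subbimodules is irreducible. -/
theorem isIrreducible_subquotient {P Q : ρ.subs} (h : P ⋖ Q) :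
    (ρ.subquotient P Q).IsIrreducible := by
  constructor
  · rw [Submodule.Quotient.nontrivial_iff]
    intro htop
    refine h.lt.not_ge ?_
    intro q hq
    have : (⟨q, hq⟩ : Q.1) ∈ P.1.comap Q.1.subtype := htop ▸ Submodule.mem_top
    exact this
  · intro R hR
    let C : Submodule F Q.1 := P.1.comap Q.1.subtype
    let R' : Submodule F V := (R.comap C.mkQ).map Q.1.subtype
    have hR' : R' ∈ ρ.subs := by
      intro x
      constructor
      · rintro _ ⟨m, hm, rfl⟩
        exact ⟨(ρ.restrict Q.1 Q.2).left x m, (hR x).1 (C.mkQ m) hm, rfl⟩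
      · rintro _ ⟨m, hm, rfl⟩
        exact ⟨(ρ.restrict Q.1 Q.2).right x m, (hR x).2 (C.mkQ m) hm, rfl⟩
    have hPR : P ≤ ⟨R', hR'⟩ := by
      intro p hp
      refine ⟨⟨p, h.le hp⟩, ?_, rfl⟩
      have : C.mkQ ⟨p, h.le hp⟩ = 0 := (Submodule.Quotient.mk_eq_zero C).mpr hp
      change C.mkQ _ ∈ R
      rw [this]; exact R.zero_mem
    have hRQ : (⟨R', hR'⟩ : ρ.subs) ≤ Q := by
      rintro _ ⟨m, _, rfl⟩
      exact m.2
    rcases h.eq_or_eq hPR hRQ with he | he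
    · left
      rw [eq_bot_iff]
      intro r hr
      obtain ⟨q, rfl⟩ := C.mkQ_surjective r
      have : (q : V) ∈ R' := ⟨q, hr, rfl⟩
      have hq : (q : V) ∈ P.1 := by rw [← he]; exact this
      exact (Submodule.Quotient.mk_eq_zero C).mpr hq
    · right
      rw [eq_top_iff]
      intro r _
      obtain ⟨q, rfl⟩ := C.mkQ_surjective r
      have : (q : V) ∈ R' := by
        have h2 : Q ≤ ⟨R', hR'⟩ := he.ge
        exact h2 q.2
      obtain ⟨q', hq', hqq⟩ := this
      have : q' = q := Subtype.ext hqq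
      subst this
      exact hq'

end Bimodule

end Bimodules

section Grothendieck

variable (F : Type u) [Field F] (L : Type v) [NonUnitalNonAssocRing L] [Module F L]

/-- Finite-dimensional irreducible `L`-bimodules. (Every finite-dimensional vector space over
`F : Type u` is isomorphic to one in `Type u`, so nothing is lost by the choice of universe.) -/
structure IrrBimodule where
  carrier : Type u
  [addCommGroup : AddCommGroup carrier]
  [module : Module F carrier]
  [finite : Module.Finite F carrier]
  bimodule : Bimodule F L carrier
  irreducible : bimodule.IsIrreducible

attribute [instance] IrrBimodule.addCommGroup IrrBimodule.module IrrBimodule.finite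

/-- Isomorphism as an equivalence relation. -/
instance IrrBimodule.setoid : Setoid (IrrBimodule F L) where
  r M N := M.bimodule.Isomorphic N.bimodule
  iseqv := ⟨fun M => .refl M.bimodule, .symm, .trans⟩

/-- The set of isomorphism classes of finite-dimensional irreducible `L`-bimodules. -/
def Irr : Type (max (u + 1) v) := Quotient (IrrBimodule.setoid F L)

/-- The additive group underlying the Grothendieck ring: the free abelian group generated by
the isomorphism classes of finite-dimensional irreducible `L`-bimodules. -/
def GrBi : Type (max (u + 1) v) := Irr F L →₀ ℤ

instance : AddCommGroup (GrBi F L) := inferInstanceAs (AddCommGroup (Irr F L →₀ ℤ))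

variable {F L}

/-- The basis element of the Grothendieck group given by an isomorphism class. -/
def GrBi.of (S : Irr F L) : GrBi F L := Finsupp.single S (1 : ℤ)

section Class

variable {V W : Type u} [AddCommGroup V] [Module F V] [Module.Finite F V]
  [AddCommGroup W] [Module F W] [Module.Finite F W]
  (ρ : Bimodule F L V) (σ : Bimodule F L W)

/-- The isomorphism class of the factor `Q / P` for a maximal inclusion `P ⋖ Q`. -/
def factor {P Q : ρ.subs} (h : P ⋖ Q) : Irr F L :=
  Quotient.mk _ ⟨_, ρ.subquotient P Q, Bimodule.isIrreducible_subquotient h⟩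

/-- The sum, in the Grothendieck group, of the classes of the factors of a chain of subbimodules
in which every member is maximal in the next one. The coefficient of `[S]` is the number of factors
isomorphic to `S`. -/
def seriesClass (s : CompositionSeries ρ.subs) : GrBi F L :=
  ∑ i : Fin s.length, GrBi.of (factor ρ (s.step i))

theorem exists_series : ∃ s : CompositionSeries ρ.subs, s.head = ⊥ ∧ s.last = ⊤ := by
  have : WellFoundedLT ρ.subs :=
    ⟨InvImage.wf (fun P : ρ.subs => (P : Submodule F V)) (wellFounded_lt (α := Submodule F V))⟩
  have : WellFoundedGT ρ.subs :=
    ⟨InvImage.wf (fun P : ρ.subs => (P : Submodule F V)) (wellFounded_gt (α := Submodule F V))⟩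
  obtain ⟨a, h0, n, hn, h⟩ :=
    exists_covBy_seq_of_wellFoundedLT_wellFoundedGT_of_le (bot_le : (⊥ : ρ.subs) ≤ ⊤)
  exact ⟨⟨n, fun i => a i, fun i => h i i.2⟩, h0, hn⟩

/-- The class `[X]` of a finite-dimensional bimodule in the Grothendieck group: the sum of
`[X : S] [S]` over all `[S]`, where `[X : S]` is the multiplicity of `S` in a composition series
`0 = X₀ ⋖ ⋯ ⋖ Xₙ = X`. By `seriesClass_eq_classOf` it does not depend on the series. -/
def classOf : GrBi F L := seriesClass ρ (exists_series ρ).choose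

variable {ρ σ}

theorem isomorphic_of_iso {X Y : ρ.subs × ρ.subs} (h : JordanHolderLattice.Iso X Y) :
    (ρ.subquotient X.1 X.2).Isomorphic (ρ.subquotient Y.1 Y.2) := by
  refine h.rel (fun X Y => (ρ.subquotient X.1 X.2).Isomorphic (ρ.subquotient Y.1 Y.2))
    (.refl _) .symm .trans ?_
  rintro P Q -
  refine Bimodule.Isomorphic.symm ?_
  let f : Q.1 →ₗ[F] (↥(P ⊔ Q).1 ⧸ P.1.comap (P ⊔ Q).1.subtype) :=
    (P.1.comap (P ⊔ Q).1.subtype).mkQ ∘ₗ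
      Submodule.inclusion (show Q.1 ≤ (P ⊔ Q).1 from (le_sup_right : Q ≤ P ⊔ Q))
  have hk : (P ⊓ Q).1.comap Q.1.subtype = LinearMap.ker f := by
    ext q
    rw [LinearMap.mem_ker]
    change _ ↔ Submodule.Quotient.mk _ = _
    rw [Submodule.Quotient.mk_eq_zero]
    exact ⟨fun hq => hq.1, fun hq => ⟨hq, q.2⟩⟩
  have hs : Function.Surjective f := by
    intro z
    obtain ⟨⟨z, hz⟩, rfl⟩ := Submodule.mkQ_surjective _ z
    obtain ⟨p, hp, q, hq, rfl⟩ := Submodule.mem_sup.mp hz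
    refine ⟨⟨q, hq⟩, ?_⟩
    refine (Submodule.Quotient.eq _).mpr ?_
    change q - (p + q) ∈ P.1
    simpa using hp
  refine ⟨(Submodule.quotEquivOfEq _ _ hk).trans (f.quotKerEquivOfSurjective hs), ?_, ?_⟩
  · intro x m
    induction m using Submodule.Quotient.induction_on
    rfl
  · intro x m
    induction m using Submodule.Quotient.induction_on
    rfl

theorem factor_eq_of_isomorphic {P Q : ρ.subs} (h : P ⋖ Q) {P' Q' : σ.subs} (h' : P' ⋖ Q')
    (hi : (ρ.subquotient P Q).Isomorphic (σ.subquotient P' Q')) : factor ρ h = factor σ h' :=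
  Quotient.sound hi

theorem seriesClass_eq_classOf (s : CompositionSeries ρ.subs) (h0 : s.head = ⊥) (h1 : s.last = ⊤) :
    seriesClass ρ s = classOf ρ := by
  obtain ⟨g0, g1⟩ := (exists_series ρ).choose_spec
  obtain ⟨f, hf⟩ := CompositionSeries.jordan_holder s (exists_series ρ).choose
    (h0.trans g0.symm) (h1.trans g1.symm)
  refine Fintype.sum_equiv f _ _ fun i => congrArg GrBi.of ?_
  exact factor_eq_of_isomorphic _ _ (isomorphic_of_iso (hf i))

/-- An isomorphism of bimodules induces an isomorphism of the lattices of subbimodules. -/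
def subsEquiv (e : V ≃ₗ[F] W) (hl : ∀ x m, e (ρ.left x m) = σ.left x (e m))
    (hr : ∀ x m, e (ρ.right x m) = σ.right x (e m)) : ρ.subs ≃o σ.subs where
  toFun P := ⟨P.1.map (e : V →ₗ[F] W), fun x =>
    ⟨by rintro _ ⟨m, hm, rfl⟩; exact ⟨_, (P.2 x).1 m hm, hl x m⟩,
     by rintro _ ⟨m, hm, rfl⟩; exact ⟨_, (P.2 x).2 m hm, hr x m⟩⟩⟩
  invFun P := ⟨P.1.comap (e : V →ₗ[F] W), fun x =>
    ⟨by intro m hm; change e _ ∈ P.1; rw [hl]; exact (P.2 x).1 _ hm,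
     by intro m hm; change e _ ∈ P.1; rw [hr]; exact (P.2 x).2 _ hm⟩⟩
  left_inv P := Subtype.ext (Submodule.comap_map_eq_of_injective e.injective _)
  right_inv P := Subtype.ext (Submodule.map_comap_eq_of_surjective e.surjective _)
  map_rel_iff' {P Q} := Submodule.map_le_map_iff_of_injective e.injective P.1 Q.1

theorem classOf_eq_of_isomorphic (h : ρ.Isomorphic σ) : classOf ρ = classOf σ := by
  obtain ⟨e, hl, hr⟩ := h
  obtain ⟨g0, g1⟩ := (exists_series ρ).choose_spec
  set s := (exists_series ρ).choose with hs
  let E := subsEquiv e hl hr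
  let t : CompositionSeries σ.subs :=
    ⟨s.length, fun i => E (s i), fun i => (apply_covBy_apply_iff E).mpr (s.step i)⟩
  have h0 : t.head = ⊥ := by
    change E s.head = ⊥
    rw [g0, map_bot]
  have h1 : t.last = ⊤ := by
    change E s.last = ⊤
    rw [g1, map_top]
  rw [← seriesClass_eq_classOf t h0 h1, ← seriesClass_eq_classOf s g0 g1]
  refine Finset.sum_congr rfl fun i _ => congrArg GrBi.of ?_
  refine factor_eq_of_isomorphic _ _ ?_
  have key : ∀ P Q : ρ.subs,
      (ρ.subquotient P Q).Isomorphic (σ.subquotient (E P) (E Q)) := by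
    intro P Q
    let eQ : Q.1 ≃ₗ[F] (E Q).1 := e.submoduleMap Q.1
    have hq : (P.1.comap Q.1.subtype).map (eQ : Q.1 →ₗ[F] (E Q).1) =
        (E P).1.comap (E Q).1.subtype := by
      ext ⟨_, m, hm, rfl⟩
      constructor
      · rintro ⟨m', hm', he⟩
        exact ⟨m', hm', congrArg Subtype.val he⟩
      · rintro ⟨m', hm', he⟩
        have : m' = m := e.injective he
        subst this
        exact ⟨⟨m', hm⟩, hm', rfl⟩
    refine ⟨Submodule.Quotient.equiv _ _ eQ hq, ?_, ?_⟩
    · intro x m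
      induction m using Submodule.Quotient.induction_on with | _ m =>
      exact congrArg (Submodule.mkQ _) (Subtype.ext (hl x m))
    · intro x m
      induction m using Submodule.Quotient.induction_on with | _ m =>
      exact congrArg (Submodule.mkQ _) (Subtype.ext (hr x m))
  exact key _ _

end Class

section Product

variable {V W V' W' : Type*} [AddCommGroup V] [Module F V] [AddCommGroup W] [Module F W]
  [AddCommGroup V'] [Module F V'] [AddCommGroup W'] [Module F W']
  {ρ : Bimodule F L V} {σ : Bimodule F L W} {ρ' : Bimodule F L V'} {σ' : Bimodule F L W'}

theorem truncSub_le_comap (e : V ≃ₗ[F] V') (f : W ≃ₗ[F] W')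
    (el : ∀ x m, e (ρ.left x m) = ρ'.left x (e m)) (er : ∀ x m, e (ρ.right x m) = ρ'.right x (e m))
    (fl : ∀ x m, f (σ.left x m) = σ'.left x (f m))
    (fr : ∀ x m, f (σ.right x m) = σ'.right x (f m)) :
    ρ.truncSub σ.toWeakBimodule ≤ (ρ'.truncSub σ'.toWeakBimodule).comap
      (TensorProduct.congr e f : V ⊗[F] W →ₗ[F] V' ⊗[F] W') := by
  have cl : ∀ x t, TensorProduct.congr e f ((ρ.tensor σ.toWeakBimodule).left x t) =
      (ρ'.tensor σ'.toWeakBimodule).left x (TensorProduct.congr e f t) := by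
    intro x t
    induction t using TensorProduct.induction_on with
    | zero => simp
    | add a b ha hb => simp only [map_add, ha, hb]
    | tmul a b => simp [el, fl]
  have cr : ∀ x t, TensorProduct.congr e f ((ρ.tensor σ.toWeakBimodule).right x t) =
      (ρ'.tensor σ'.toWeakBimodule).right x (TensorProduct.congr e f t) := by
    intro x t
    induction t using TensorProduct.induction_on with
    | zero => simp
    | add a b ha hb => simp only [map_add, ha, hb]
    | tmul a b => simp [er, fr]
  refine sInf_le ⟨fun x => ⟨fun t ht => ?_, fun t ht => ?_⟩, ?_⟩
  · rw [Submodule.mem_comap] at ht ⊢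
    have := (ρ'.truncSub_mem σ'.toWeakBimodule x).1 _ ht
    exact (cl x t) ▸ this
  · rw [Submodule.mem_comap] at ht ⊢
    have := (ρ'.truncSub_mem σ'.toWeakBimodule x).2 _ ht
    exact (cr x t) ▸ this
  · rintro _ ⟨x, y, m, n, rfl⟩
    exact ρ'.truncSet_subset σ'.toWeakBimodule
      ⟨x, y, e m, f n, by simp [el, er, fl, fr]⟩

theorem truncTensor_isomorphic (h : ρ.Isomorphic ρ') (h' : σ.Isomorphic σ') :
    (ρ.truncTensor σ).Isomorphic (ρ'.truncTensor σ') := by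
  obtain ⟨e, el, er⟩ := h
  obtain ⟨f, fl, fr⟩ := h'
  have h1 := truncSub_le_comap e f el er fl fr
  have h2 := truncSub_le_comap (ρ := ρ') (ρ' := ρ) (σ := σ') (σ' := σ) e.symm f.symm
    (fun x m => by rw [LinearEquiv.symm_apply_eq, el, LinearEquiv.apply_symm_apply])
    (fun x m => by rw [LinearEquiv.symm_apply_eq, er, LinearEquiv.apply_symm_apply])
    (fun x m => by rw [LinearEquiv.symm_apply_eq, fl, LinearEquiv.apply_symm_apply])
    (fun x m => by rw [LinearEquiv.symm_apply_eq, fr, LinearEquiv.apply_symm_apply])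
  have hq : (ρ.truncSub σ.toWeakBimodule).map
      (TensorProduct.congr e f : V ⊗[F] W →ₗ[F] V' ⊗[F] W') = ρ'.truncSub σ'.toWeakBimodule := by
    refine le_antisymm (Submodule.map_le_iff_le_comap.mpr h1) fun t ht => ?_
    exact ⟨_, h2 ht, (TensorProduct.congr e f).apply_symm_apply t⟩
  refine ⟨Submodule.Quotient.equiv _ _ (TensorProduct.congr e f) hq, ?_, ?_⟩
  · intro x t
    induction t using Submodule.Quotient.induction_on with | _ t =>
    refine congrArg (Submodule.mkQ _) ?_
    induction t using TensorProduct.induction_on with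
    | zero => simp
    | add a b ha hb => simp only [map_add, ha, hb]
    | tmul a b => simp [el, fl]
  · intro x t
    induction t using Submodule.Quotient.induction_on with | _ t =>
    refine congrArg (Submodule.mkQ _) ?_
    induction t using TensorProduct.induction_on with
    | zero => simp
    | add a b ha hb => simp only [map_add, ha, hb]
    | tmul a b => simp [er, fr]

end Product

/-- The product of two basis elements: `[M] · [N]` is the class of the truncated tensor product of
`M` and `N`. -/
def basisMul (S T : Irr F L) : GrBi F L :=
  Quotient.liftOn₂ S T (fun M N => classOf (M.bimodule.truncTensor N.bimodule))
    fun _ _ _ _ h h' => classOf_eq_of_isomorphic (truncTensor_isomorphic h h')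

/-- The biadditive extension of the product of basis elements. -/
def GrBi.mulHom : GrBi F L →+ GrBi F L →+ GrBi F L :=
  Finsupp.liftAddHom (α := Irr F L) (M := ℤ) fun S =>
    zmultiplesHom (GrBi F L →+ GrBi F L) <|
      Finsupp.liftAddHom (α := Irr F L) (M := ℤ) fun T => zmultiplesHom (GrBi F L) (basisMul S T)

/-- The Grothendieck ring of the category of finite-dimensional `L`-bimodules. -/
instance : NonUnitalNonAssocRing (GrBi F L) where
  mul a b := GrBi.mulHom a b
  left_distrib a b c := map_add (GrBi.mulHom a) b c
  right_distrib a b c := DFunLike.congr_fun (map_add GrBi.mulHom a b) c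
  zero_mul a := DFunLike.congr_fun (map_zero GrBi.mulHom) a
  mul_zero a := map_zero (GrBi.mulHom a)

theorem GrBi.of_mul_of (S T : Irr F L) : GrBi.of S * GrBi.of T = basisMul S T := by
  change GrBi.mulHom (GrBi.of S) (GrBi.of T) = _
  unfold GrBi.mulHom GrBi.of
  erw [Finsupp.liftAddHom_apply_single, zmultiplesHom_apply, one_smul,
    Finsupp.liftAddHom_apply_single, zmultiplesHom_apply, one_smul]

end Grothendieck

end Leibniz

end

/-! A left module `V` becomes a bimodule in two ways: symmetrically, `V_s`, with right action minus
the left one, and antisymmetrically, `V_a`, with right action zero. Take `V` finite-dimensional and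
irreducible with non-zero action. The two bracketings of `[V*_s]`, `[V_s]`, `[V_a]` give different
products.

On the one hand, the defining elements of `T(V_s, V_a)` reduce to `-(y·m) ⊗ (x·n)`. Since `L·V`
spans `V`, they span `V ⊗ V`, so `[V_s]·[V_a] = 0` (`truncSub_symm_antisymm_eq_top`) and one
bracketing is zero.

On the other hand, for two symmetric bimodules all defining elements of `T` vanish, so the
evaluation pairing descends to a non-zero invariant functional on the truncated product of `V*_s`
and `V_s` (`exists_invariant_functional`). That product therefore has a composition factor `S` with
zero actions (`exists_trivial_factor`). For such `S` nothing is truncated in the product with `V_a`,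
so `[S]·[V_a]` is non-zero. Products of basis elements have non-negative coefficients, so no
cancellation occurs; this is measured by the additive map `GrBi.length`.

Such a `V` comes from a maximal ideal `I` of the canonical Lie algebra `g`, which is non-zero: a
non-zero character if `g/I` is abelian, the adjoint action on `g/I` otherwise. -/

open scoped TensorProduct

noncomputable section

namespace Leibniz

/-! ### Left modules, their symmetric and antisymmetric bimodules, and truncation -/

section LeftModules

variable {F : Type u} [Field F] {L : Type v} [NonUnitalNonAssocRing L] [Module F L]

variable (F L) in
/-- A left action of `L` on `V` satisfying (LLM), i.e. a representation of the canonical Lie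
algebra. -/
structure LeftModule (V : Type*) [AddCommGroup V] [Module F V] where
  act : L →ₗ[F] V →ₗ[F] V
  llm : ∀ x y m, act (x * y) m = act x (act y m) - act y (act x m)

namespace LeftModule

variable {V W : Type*} [AddCommGroup V] [Module F V] [AddCommGroup W] [Module F W]
  (A : LeftModule F L V)

/-- Irreducibility of a left module. -/
def IsIrreducible : Prop :=
  Nontrivial V ∧ ∀ P : Submodule F V, (∀ x, ∀ m ∈ P, A.act x m ∈ P) → P = ⊥ ∨ P = ⊤

/-- The action is not identically zero. -/
def ActsNontrivially : Prop := ∃ x m, A.act x m ≠ 0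

/-- The symmetric bimodule `m · x = -(x · m)`. -/
def symm : Bimodule F L V where
  left := A.act
  right := -A.act
  llm := A.llm
  lml x y m := by simp [A.llm]; abel
  mll x y m := by simp [A.llm]

@[simp] theorem symm_left (x : L) (m : V) : A.symm.left x m = A.act x m := rfl

@[simp] theorem symm_right (x : L) (m : V) : A.symm.right x m = -A.act x m := rfl

/-- The antisymmetric bimodule `m · x = 0`. -/
def antisymm : Bimodule F L V where
  left := A.act
  right := 0
  llm := A.llm
  lml x y m := by simp
  mll x y m := by simp

/-- The contragredient left module. -/
def dual : LeftModule F L (Module.Dual F V) where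
  act := LinearMap.mk₂ F (fun x f => -(f ∘ₗ A.act x))
    (by intros; ext; simp; abel) (by intros; ext; simp) (by intros; ext; simp; abel)
    (by intros; ext; simp)
  llm x y f := by ext m; simp [A.llm]

@[simp] theorem dual_act (x : L) (f : Module.Dual F V) (m : V) :
    A.dual.act x f m = -f (A.act x m) := rfl

/-- Transport of a left module along a linear equivalence. -/
def transport (e : V ≃ₗ[F] W) : LeftModule F L W where
  act := LinearMap.mk₂ F (fun x w => e (A.act x (e.symm w)))
    (by intros; simp) (by intros; simp) (by intros; simp) (by intros; simp)
  llm x y m := by simp [A.llm]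

@[simp] theorem transport_act (e : V ≃ₗ[F] W) (x : L) (w : W) :
    (A.transport e).act x w = e (A.act x (e.symm w)) := rfl

variable {A}

theorem IsIrreducible.symm (h : A.IsIrreducible) : A.symm.IsIrreducible :=
  ⟨h.1, fun P hP => h.2 P fun x => (hP x).1⟩

theorem IsIrreducible.antisymm (h : A.IsIrreducible) : A.antisymm.IsIrreducible :=
  ⟨h.1, fun P hP => h.2 P fun x => (hP x).1⟩

theorem IsIrreducible.transport (h : A.IsIrreducible) (e : V ≃ₗ[F] W) :
    (A.transport e).IsIrreducible := by
  have := h.1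
  refine ⟨e.symm.toEquiv.nontrivial, fun P hP => ?_⟩
  have hP' := h.2 (P.comap (e : V →ₗ[F] W)) fun x m hm => by simpa using hP x (e m) hm
  have hm : (P.comap (e : V →ₗ[F] W)).map (e : V →ₗ[F] W) = P :=
    Submodule.map_comap_eq_of_surjective e.surjective P
  rcases hP' with h | h
  · left; rw [← hm, h, Submodule.map_bot]
  · right; rw [← hm, h, Submodule.map_top, LinearMap.range_eq_top]; exact e.surjective

theorem ActsNontrivially.transport (h : A.ActsNontrivially) (e : V ≃ₗ[F] W) :
    (A.transport e).ActsNontrivially := by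
  obtain ⟨x, m, h⟩ := h
  exact ⟨x, e m, by simpa using h⟩

/-- The common kernel of an invariant space of functionals is an invariant subspace of `V`, and
finite dimension lets the functionals be recovered as its annihilator. -/
theorem IsIrreducible.dual [FiniteDimensional F V] (h : A.IsIrreducible) :
    A.dual.IsIrreducible := by
  have := h.1
  refine ⟨inferInstance, fun P hP => ?_⟩
  have hP' := h.2 P.dualCoannihilator fun x m hm => by
    rw [Submodule.mem_dualCoannihilator] at hm ⊢
    intro f hf
    simpa using hm _ (hP x f hf)
  have hm : P.dualCoannihilator.dualAnnihilator = P :=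
    Subspace.dualCoannihilator_dualAnnihilator_eq
  rcases hP' with h | h
  · right; rw [← hm, h, Submodule.dualAnnihilator_bot]
  · left; rw [← hm, h, Submodule.dualAnnihilator_top]

/-- An irreducible left module with non-zero action is spanned by the elements `x · m`. -/
theorem IsIrreducible.span_act_eq_top (h : A.IsIrreducible) (h' : A.ActsNontrivially) :
    Submodule.span F {v | ∃ x m, v = A.act x m} = ⊤ := by
  -- The span is invariant because it contains `x · m` for every `m` in `V`.
  refine (h.2 (Submodule.span F {v | ∃ x m, v = A.act x m}) fun x m _ =>
    Submodule.subset_span ⟨x, m, rfl⟩).resolve_left fun hb => ?_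
  obtain ⟨x, m, hxm⟩ := h'
  exact hxm (Submodule.span_eq_bot.mp hb (A.act x m) ⟨x, m, rfl⟩)

/-- In a defining element of `T`, symmetry on the left kills `x·m + m·x` and antisymmetry on the
right kills `n·y`; what is left is `-(y·m) ⊗ (x·n)`. Both tensor factors range over spanning sets of
`V`. -/
theorem truncSub_symm_antisymm_eq_top (h : A.IsIrreducible) (h' : A.ActsNontrivially) :
    A.symm.truncSub A.antisymm.toWeakBimodule = ⊤ := by
  have key : ∀ v w, v ⊗ₜ[F] w ∈ A.symm.truncSub A.antisymm.toWeakBimodule := by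
    intro v w
    have hv : v ∈ Submodule.span F {v | ∃ x m, v = A.act x m} := by
      rw [h.span_act_eq_top h']; trivial
    have hw : w ∈ Submodule.span F {v | ∃ x m, v = A.act x m} := by
      rw [h.span_act_eq_top h']; trivial
    induction hv, hw using Submodule.span_induction₂ with
    | mem_mem v w hv hw =>
      obtain ⟨y, m, rfl⟩ := hv
      obtain ⟨x, n, rfl⟩ := hw
      rw [← neg_mem_iff]
      refine WeakBimodule.truncSet_subset _ _ ⟨x, y, m, n, ?_⟩
      simp [symm, antisymm, TensorProduct.neg_tmul]
    | zero_left => simp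
    | zero_right => simp
    | add_left a b c _ _ _ ha hb => rw [TensorProduct.add_tmul]; exact add_mem ha hb
    | add_right a b c _ _ _ ha hb => rw [TensorProduct.tmul_add]; exact add_mem ha hb
    | smul_left r a b _ _ ha =>
      rw [← TensorProduct.smul_tmul']; exact Submodule.smul_mem _ r ha
    | smul_right r a b _ _ ha =>
      rw [TensorProduct.tmul_smul]; exact Submodule.smul_mem _ r ha
  rw [eq_top_iff]
  intro t _
  induction t using TensorProduct.induction_on with
  | zero => exact zero_mem _
  | add a b ha hb => exact add_mem (ha trivial) (hb trivial)
  | tmul v w => exact key v w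

/-- A non-zero invariant pairing of left modules induces a non-zero functional on the truncated
tensor product of the symmetric bimodules that vanishes on all `x · t` and `t · x`. -/
theorem exists_invariant_functional (B : LeftModule F L W) (β : V →ₗ[F] W →ₗ[F] F) (hβ : β ≠ 0)
    (hinv : ∀ x v w, β (A.act x v) w = -β v (B.act x w)) :
    ∃ φ : Module.Dual F ((V ⊗[F] W) ⧸ A.symm.truncSub B.symm.toWeakBimodule),
      φ ≠ 0 ∧ (∀ x t, φ ((A.symm.truncTensor B.symm).left x t) = 0) ∧
        ∀ x t, φ ((A.symm.truncTensor B.symm).right x t) = 0 := by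
  -- Invariance makes the two Leibniz terms cancel; the right actions are the negatives of the left
  -- ones, so the same holds for them.
  have hl : ∀ x t, TensorProduct.lift β ((A.symm.tensor B.symm.toWeakBimodule).left x t) = 0 := by
    intro x t
    induction t using TensorProduct.induction_on with
    | zero => simp
    | add a b ha hb => simp only [map_add, ha, hb, add_zero]
    | tmul v w => simp [hinv]
  have hr : ∀ x t, TensorProduct.lift β ((A.symm.tensor B.symm.toWeakBimodule).right x t) = 0 := by
    intro x t
    induction t using TensorProduct.induction_on with
    | zero => simp
    | add a b ha hb => simp only [map_add, ha, hb, add_zero]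
    | tmul v w => simp [hinv]
  have hker : A.symm.truncSub B.symm.toWeakBimodule ≤ LinearMap.ker (TensorProduct.lift β) := by
    refine sInf_le ⟨fun x => ⟨fun t _ => hl x t, fun t _ => hr x t⟩, ?_⟩
    rintro _ ⟨x, y, m, n, rfl⟩
    -- Both factors `x·m + m·x` and `x·n + n·x` are zero for symmetric bimodules, so the defining
    -- element itself is zero.
    simp
  refine ⟨Submodule.liftQ _ (TensorProduct.lift β) hker, fun h => hβ ?_, ?_, ?_⟩
  · ext v w
    exact LinearMap.congr_fun h (Submodule.Quotient.mk (v ⊗ₜ w))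
  · intro x t
    induction t using Submodule.Quotient.induction_on with | _ t =>
    exact hl x t
  · intro x t
    induction t using Submodule.Quotient.induction_on with | _ t =>
    exact hr x t

end LeftModule

/-- If `L` acts trivially on `M` from both sides, then `T(M, N_a) = 0`. -/
theorem truncSub_antisymm_eq_bot {V W : Type*} [AddCommGroup V] [Module F V] [AddCommGroup W]
    [Module F W] (ρ : Bimodule F L V) (A : LeftModule F L W) (hl : ∀ x m, ρ.left x m = 0)
    (hr : ∀ x m, ρ.right x m = 0) : ρ.truncSub A.antisymm.toWeakBimodule = ⊥ := by
  rw [eq_bot_iff]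
  refine sInf_le ⟨WeakBimodule.bot_mem_subs _, ?_⟩
  rintro _ ⟨x, y, m, n, rfl⟩
  -- In each of the two summands the factor from `M` is zero.
  simp [hl, hr]

end LeftModules

/-! ### Existence of an irreducible left module with non-zero action -/

section Existence

variable (F : Type u) [Field F] (L : Type v) [NonUnitalNonAssocRing L] [Module F L]
    [IsScalarTower F L L] [SMulCommClass F L L] [IsLeibniz L]

theorem nontrivial_canonicalLie [Nontrivial L] : Nontrivial (CanonicalLie F L) := by
  rw [Submodule.Quotient.nontrivial_iff]
  intro h
  -- The Leibniz kernel annihilates `L` from the left. If it were all of `L`, every square would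
  -- vanish and the kernel would be zero.
  have hz : ∀ x y : L, x * y = 0 := fun x y => kernel_mul F L (h ▸ Submodule.mem_top) y
  refine (bot_ne_top (α := Submodule F L)) ?_
  rw [← h, eq_comm, kernel, Submodule.span_eq_bot]
  rintro _ ⟨x, rfl⟩
  exact hz x x

/-- The left module given by a module over the canonical Lie algebra. -/
def LeftModule.ofLieModule (V : Type*) [AddCommGroup V] [Module F V]
    [LieRingModule (CanonicalLie F L) V] [LieModule F (CanonicalLie F L) V] :
    LeftModule F L V where
  act := (LieModule.toEnd F (CanonicalLie F L) V : CanonicalLie F L →ₗ[F] V →ₗ[F] V) ∘ₗ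
    (kernel F L).mkQ
  llm x y m := by
    have : (kernel F L).mkQ (x * y) = ⁅(kernel F L).mkQ x, (kernel F L).mkQ y⁆ := rfl
    simp only [LinearMap.comp_apply, this]
    exact lie_lie _ _ _

/-- The one-dimensional left module given by a character of the canonical Lie algebra. -/
def LeftModule.ofCharacter (φ : Module.Dual F (CanonicalLie F L))
    (h : ∀ x y : CanonicalLie F L, φ ⁅x, y⁆ = 0) : LeftModule F L F where
  act := LinearMap.lsmul F F ∘ₗ φ ∘ₗ (kernel F L).mkQ
  llm x y m := by
    have : (kernel F L).mkQ (x * y) = ⁅(kernel F L).mkQ x, (kernel F L).mkQ y⁆ := rfl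
    simp only [LinearMap.comp_apply, this, h]
    simp [mul_left_comm]

/-- A non-zero Leibniz algebra with finite-dimensional canonical Lie algebra has a
finite-dimensional irreducible left module on which it does not act by zero. -/
theorem exists_irreducible_actsNontrivially [Nontrivial L]
    [FiniteDimensional F (CanonicalLie F L)] :
    ∃ (V : Type u) (_ : AddCommGroup V) (_ : Module F V) (_ : Module.Finite F V)
      (A : LeftModule F L V), A.IsIrreducible ∧ A.ActsNontrivially := by
  have := nontrivial_canonicalLie F L
  obtain ⟨I, hI⟩ := IsCoatomic.exists_coatom (α := LieIdeal F (CanonicalLie F L))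
  -- The case where the quotient by `I` is abelian: any non-zero functional vanishing on `I` is then
  -- a character.
  by_cases h : ∀ x y : CanonicalLie F L, ⁅x, y⁆ ∈ I
  · have hlt : I.toSubmodule < ⊤ := by
      rw [lt_top_iff_ne_top]
      intro ht
      exact hI.1 (LieSubmodule.toSubmodule_injective ht)
    obtain ⟨φ, hφ, hker⟩ := Submodule.exists_le_ker_of_lt_top _ hlt
    refine ⟨F, inferInstance, inferInstance, inferInstance,
      LeftModule.ofCharacter F L φ fun x y => hker (h x y), ⟨inferInstance, fun P _ => ?_⟩, ?_⟩
    · exact eq_bot_or_eq_top (α := Ideal F) P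
    · obtain ⟨x, hx⟩ : ∃ x, φ x ≠ 0 := by
        by_contra! h0
        exact hφ (LinearMap.ext h0)
      obtain ⟨x, rfl⟩ := (kernel F L).mkQ_surjective x
      exact ⟨x, 1, by simpa [LeftModule.ofCharacter] using hx⟩
  · push Not at h
    obtain ⟨x, y, hxy⟩ := h
    let A := LeftModule.ofLieModule F L (CanonicalLie F L ⧸ I)
    have hA : A.ActsNontrivially := by
      obtain ⟨x, rfl⟩ := (kernel F L).mkQ_surjective x
      refine ⟨x, LieSubmodule.Quotient.mk y, fun h0 => hxy ?_⟩
      rw [← LieSubmodule.Quotient.mk_eq_zero']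
      exact h0
    have hA' : A.IsIrreducible := by
      constructor
      · obtain ⟨x, m, h⟩ := hA
        exact ⟨_, _, h⟩
      · intro P hP
        -- The preimage of a submodule of the quotient is an ideal containing `I`, so maximality of
        -- `I` leaves only two choices.
        let J : LieIdeal F (CanonicalLie F L) :=
          { P.comap I.toSubmodule.mkQ with
            lie_mem := by
              intro x m hm
              obtain ⟨x, rfl⟩ := (kernel F L).mkQ_surjective x
              exact hP x _ hm }
        have hm : (P.comap I.toSubmodule.mkQ).map I.toSubmodule.mkQ = P :=
          Submodule.map_comap_eq_of_surjective (Submodule.mkQ_surjective _) P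
        have hIJ : I ≤ J := fun m hm => by
          change I.toSubmodule.mkQ m ∈ P
          have h0 : I.toSubmodule.mkQ m = 0 := (Submodule.Quotient.mk_eq_zero I.toSubmodule).mpr hm
          exact h0 ▸ P.zero_mem
        have hJ : J.toSubmodule = P.comap I.toSubmodule.mkQ := rfl
        rcases eq_or_lt_of_le hIJ with h | h
        · left
          rw [← hm, ← hJ, ← h]
          exact Submodule.mkQ_map_self _
        · right
          rw [← hm, ← hJ, hI.2 _ h]
          simp
    -- The quotient lives in `Type v`; coordinates move it to `Fin n → F` in `Type u`, as
    -- `IrrBimodule` requires.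
    let e := (Module.finBasis F (CanonicalLie F L ⧸ I)).equivFun
    exact ⟨_, _, _, inferInstance, A.transport e, hA'.transport e, hA.transport e⟩

end Existence

/-! ### Length in the Grothendieck group and trivial composition factors -/

section Length

variable {F : Type u} [Field F] {L : Type v} [NonUnitalNonAssocRing L] [Module F L]

/-- The length: the sum of all coefficients. -/
def GrBi.length : GrBi F L →+ ℤ :=
  Finsupp.liftAddHom (α := Irr F L) (M := ℤ) fun _ => AddMonoidHom.id ℤ

theorem GrBi.length_of (S : Irr F L) : GrBi.length (GrBi.of S) = 1 := by
  unfold GrBi.length GrBi.of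
  erw [Finsupp.liftAddHom_apply_single]
  rfl

variable {V : Type u} [AddCommGroup V] [Module F V] [Module.Finite F V]
  (ρ : Bimodule F L V)

theorem length_seriesClass (s : CompositionSeries ρ.subs) :
    GrBi.length (seriesClass ρ s) = s.length := by
  simp [seriesClass, map_sum, GrBi.length_of]

theorem length_classOf_nonneg : 0 ≤ GrBi.length (classOf ρ) := by
  rw [classOf, length_seriesClass]; positivity

theorem length_classOf_pos [Nontrivial V] : 0 < GrBi.length (classOf ρ) := by
  obtain ⟨h0, h1⟩ := (exists_series ρ).choose_spec
  rw [classOf, length_seriesClass, Nat.cast_pos, Nat.pos_iff_ne_zero]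
  intro hl
  have : (exists_series ρ).choose.head = (exists_series ρ).choose.last := by
    unfold RelSeries.head RelSeries.last
    congr 1
    ext
    exact hl.symm
  rw [h0, h1] at this
  exact bot_ne_top (α := Submodule F V) (congrArg Subtype.val this)

theorem classOf_eq_zero [Subsingleton V] : classOf ρ = 0 := by
  have : Subsingleton ρ.subs := inferInstance
  unfold classOf seriesClass
  refine Finset.sum_eq_zero fun i _ => ?_
  exact absurd (Subsingleton.elim _ _) ((exists_series ρ).choose.step i).lt.ne

/-- If `φ ≠ 0` is a functional that vanishes on all `x · m` and `m · x`, then every composition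
series has a factor on which `L` acts by zero. -/
theorem exists_trivial_factor (φ : Module.Dual F V) (hφ : φ ≠ 0)
    (hl : ∀ x m, φ (ρ.left x m) = 0) (hr : ∀ x m, φ (ρ.right x m) = 0)
    (s : CompositionSeries ρ.subs) (h0 : s.head = ⊥) (h1 : s.last = ⊤) :
    ∃ i : Fin s.length,
      (∀ x m, (ρ.subquotient (s i.castSucc) (s i.succ)).left x m = 0) ∧
      ∀ x m, (ρ.subquotient (s i.castSucc) (s i.succ)).right x m = 0 := by
  -- The series starts inside the kernel of `φ` and ends outside it; `i` is a step at which it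
  -- leaves.
  obtain ⟨i, hi, hi'⟩ : ∃ i : Fin s.length,
      (s i.castSucc).1 ≤ LinearMap.ker φ ∧ ¬ (s i.succ).1 ≤ LinearMap.ker φ := by
    by_contra! h
    have key : ∀ i : Fin (s.length + 1), (s i).1 ≤ LinearMap.ker φ := by
      intro i
      induction i using Fin.induction with
      | zero =>
        have : s 0 = ⊥ := h0
        rw [this]; exact bot_le
      | succ i hi => exact h i hi
    have h2 := key (Fin.last _)
    have h3 : s (Fin.last _) = ⊤ := h1
    rw [h3] at h2
    exact hφ (LinearMap.ker_eq_top.mp (top_le_iff.mp h2))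
  refine ⟨i, ?_⟩
  let K : ρ.subs := ⟨LinearMap.ker φ, fun x => ⟨fun m _ => hl x m, fun m _ => hr x m⟩⟩
  have hle : s i.castSucc ≤ s i.succ ⊓ K := le_inf (s.step i).le hi
  -- The intersection lies between two consecutive members and is not the upper one. Since `φ` kills
  -- all `x · m` and `m · x`, both actions send the upper member into this intersection, hence act
  -- by zero on the factor.
  have hK : s i.succ ⊓ K = s i.castSucc := by
    refine ((s.step i).eq_or_eq hle inf_le_left).resolve_right fun h => hi' ?_
    exact (show s i.succ ≤ K from inf_eq_left.mp h)
  constructor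
  · intro x m
    induction m using Submodule.Quotient.induction_on with | _ m =>
    refine (Submodule.Quotient.mk_eq_zero _).mpr ?_
    change ρ.left x m ∈ (s i.castSucc).1
    rw [← hK]
    exact ⟨((s i.succ).2 x).1 m m.2, hl x m⟩
  · intro x m
    induction m using Submodule.Quotient.induction_on with | _ m =>
    refine (Submodule.Quotient.mk_eq_zero _).mpr ?_
    change ρ.right x m ∈ (s i.castSucc).1
    rw [← hK]
    exact ⟨((s i.succ).2 x).2 m m.2, hr x m⟩

theorem length_basisMul_nonneg (S T : Irr F L) : 0 ≤ GrBi.length (basisMul S T) := by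
  induction S, T using Quotient.inductionOn₂ with | _ M N =>
  exact length_classOf_nonneg _

/-- The class of an irreducible bimodule. -/
def irrMk {V : Type u} [AddCommGroup V] [Module F V] [Module.Finite F V] (ρ : Bimodule F L V)
    (h : ρ.IsIrreducible) : Irr F L := Quotient.mk _ ⟨V, ρ, h⟩

/-- With zero actions on the first bimodule `T` is zero, so the truncated product is the full tensor
product of two non-zero spaces. -/
theorem length_basisMul_antisymm_pos {V W : Type u} [AddCommGroup V] [Module F V]
    [Module.Finite F V] [AddCommGroup W] [Module F W] [Module.Finite F W] (ρ : Bimodule F L V)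
    (h : ρ.IsIrreducible) (hl : ∀ x m, ρ.left x m = 0) (hr : ∀ x m, ρ.right x m = 0)
    (A : LeftModule F L W) (hA : A.IsIrreducible) :
    0 < GrBi.length (basisMul (irrMk ρ h) (irrMk A.antisymm hA.antisymm)) := by
  have := h.1
  have := hA.1
  have : Nontrivial ((V ⊗[F] W) ⧸ ρ.truncSub A.antisymm.toWeakBimodule) := by
    rw [Submodule.Quotient.nontrivial_iff, truncSub_antisymm_eq_bot ρ A hl hr]
    have : Nontrivial (V ⊗[F] W) := by
      apply Module.nontrivial_of_finrank_pos (R := F)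
      rw [Module.finrank_tensorProduct]
      exact Nat.mul_pos Module.finrank_pos Module.finrank_pos
    exact bot_ne_top
  exact length_classOf_pos (ρ.truncTensor A.antisymm)

end Length

end Leibniz

end

/-! ### A triple of basis elements that does not associate -/

theorem proposition4p10 (F : Type u) [Field F] (L : Type v) [NonUnitalNonAssocRing L] [Module F L]
    [IsScalarTower F L L] [SMulCommClass F L L] [Leibniz.IsLeibniz L] [Nontrivial L]
    [FiniteDimensional F (Leibniz.CanonicalLie F L)] :
    ¬ ∀ a b c : Leibniz.GrBi F L, (a * b) * c = a * (b * c) := by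
  open Leibniz in
  intro hassoc
  obtain ⟨V, _, _, _, A, hA, hA'⟩ := exists_irreducible_actsNontrivially F L
  have := hA.1
  have h := congrArg GrBi.length (hassoc (GrBi.of (irrMk A.dual.symm hA.dual.symm))
    (GrBi.of (irrMk A.symm hA.symm)) (GrBi.of (irrMk A.antisymm hA.antisymm)))
  have hzero : basisMul (irrMk A.symm hA.symm) (irrMk A.antisymm hA.antisymm) = 0 := by
    have : Subsingleton ((V ⊗[F] V) ⧸ A.symm.truncSub A.antisymm.toWeakBimodule) := by
      rw [Submodule.Quotient.subsingleton_iff]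
      exact LeftModule.truncSub_symm_antisymm_eq_top hA hA'
    exact classOf_eq_zero (A.symm.truncTensor A.antisymm)
  rw [GrBi.of_mul_of, GrBi.of_mul_of, hzero, mul_zero, map_zero] at h
  -- As a map from the dual of `V` to itself, the evaluation pairing is the identity; its invariance
  -- is the definition of the contragredient action.
  obtain ⟨φ, hφ, hl, hr⟩ := A.dual.exists_invariant_functional A LinearMap.id
    (fun h0 => by
      obtain ⟨f, hf⟩ := exists_ne (0 : Module.Dual F V)
      exact hf (LinearMap.congr_fun h0 f))
    fun _ _ _ => rfl
  obtain ⟨s, h0, h1⟩ := exists_series (A.dual.symm.truncTensor A.symm)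
  obtain ⟨i, hil, hir⟩ := exists_trivial_factor _ φ hφ hl hr s h0 h1
  have hs : basisMul (irrMk A.dual.symm hA.dual.symm) (irrMk A.symm hA.symm) =
      seriesClass (A.dual.symm.truncTensor A.symm) s :=
    (seriesClass_eq_classOf s h0 h1).symm
  rw [hs, seriesClass, Finset.sum_mul, map_sum] at h
  -- The left side is the sum of the lengths of `[S_j]·[V_a]` over the factors `S_j` of the series:
  -- all are non-negative, and the trivial factor contributes a positive one.
  refine (Finset.sum_pos' (fun j _ => ?_) ⟨i, Finset.mem_univ i, ?_⟩).ne' h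
  · rw [GrBi.of_mul_of]
    exact length_basisMul_nonneg _ _
  · rw [GrBi.of_mul_of]
    exact length_basisMul_antisymm_pos _ (Bimodule.isIrreducible_subquotient (s.step i)) hil hir A hA
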